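/- A system of $k$ congruences is a collection $\{r_1 \ (\mathrm{mod}\ m_1),\dots,r_k\ (\mathrm{mod}\ m_k)\}$ of congruence classes with $r_i\in\mathbb{Z}$ and integers $m_i\ge 2$. It is a covering system if every integer $n$ satisfies $n\equiv r_i \pmod{m_i}$ for some $1\le i\le k$, and it is distinct if the moduli $m_1,\dots,m_k$ are pairwise distinct. The minimum cardinality (number of congruences) of a distinct covering system all of whose moduli exceed $2$ is exactly $11$. That is, every distinct covering system whose moduli all exceed $2$ has at least $11$ congruences, and there is one with exactly $11$ congruences. Specifically, writing $[r,m]$ for $r\ (\mathrm{mod}\ m)$, Krukenberg's system $$\{[2,3],\ [0,4],\ [1,6],\ [2,8],\ [0,9],\ [3,12],\ [6,16],\ [3,18],\ [6,24],\ [33,36],\ [46,48]\}$$ is a distinct covering system whose moduli all exceed $2$. -/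

import Mathlib

/-- A system of `k` congruence classes `residue i (mod modulus i)`, with all moduli at least `2`. -/
structure CongruenceSystem (k : ℕ) where
  residue : Fin k → ℤ
  modulus : Fin k → ℕ
  two_le_modulus : ∀ i, 2 ≤ modulus i

namespace CongruenceSystem

/-- Every integer satisfies at least one of the congruences. -/
def IsCovering {k : ℕ} (S : CongruenceSystem k) : Prop :=
  ∀ n : ℤ, ∃ i, n ≡ S.residue i [ZMOD (S.modulus i : ℤ)]

/-- The moduli are pairwise distinct. In that case the `k` congruence classes are pairwise
different too, so that `k` is the cardinality of the system. -/
def IsDistinct {k : ℕ} (S : CongruenceSystem k) : Prop :=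
  Function.Injective S.modulus

/-- The system of congruences modulo `3, 4, 6, 8, 9, 12, 16, 18, 24, 36, 48` due to Krukenberg. -/
def krukenberg : CongruenceSystem 11 where
  residue := ![2, 0, 1, 2, 0, 3, 6, 3, 6, 33, 46]
  modulus := ![3, 4, 6, 8, 9, 12, 16, 18, 24, 36, 48]
  two_le_modulus := by decide

end CongruenceSystem

/-!
Krukenberg's system covers because it covers the residues modulo `144`, the least common multiple
of its moduli. The content is that ten distinct moduli greater than `2` never suffice.

The first step bounds the least common multiple `L` of the moduli of an irredundant cover.
Writing an integer through its base `p` digits for all primes `p ∣ L` turns `ℤ / L` into a box, with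
one coordinate of size `p` for each of the `v_p(L)` digits, and turns a congruence class modulo
`m ∣ L` into a subbox that prescribes the first `v_p(m)` digits at each `p`. An irredundant cover of
a box by such subboxes has more than `∑ (b_j - 1)` members, where `b_j` are the sizes of the
coordinates that occur (`sum_pred_lt_card_of_irredundant`). This generalizes Tarsi's lemma on
minimally unsatisfiable formulas, and like it follows from Hall's marriage theorem. Hence an
irredundant cover has more than `∑ v_p(L) (p - 1)` members, a theorem of Simpson
(`sum_factorization_mul_lt_card`), and for at most ten congruences this forces `L` to divide one of
eleven explicit numbers `N` (`dvd_of_sum_factorization_le`).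

It remains to see that, for each of these `N`, no ten distinct divisors of `N` exceeding `2` are the
moduli of a cover. This is a finite search (`refute`), evaluated in the kernel. It goes
through the divisors in increasing order and decides for each whether it is used and with which
residue. Two observations keep it small. If the classes chosen so far have moduli dividing `l`, then
the uncovered set is invariant under translation by `l`, so the residue of the next modulus `m` may
be taken less than `gcd l m`. And a branch is closed as soon as the number of uncovered residues
exceeds what the remaining moduli can cover, when each is credited with its best class in the present
uncovered set (or, for large moduli, with the size of a whole class).
-/

section

open Finset

/-! ### Irredundant covers of a box -/

/-- Under Hall's condition, each subbox `i` can be matched with a coordinate `j ∈ supp i` in such a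
way that `j` serves at most `b j - 1` subboxes. Then every coordinate has a value left that
avoids all the subboxes it serves, and the subboxes do not cover the box. -/
theorem exists_forall_ne_of_hall {α V : Type*} [DecidableEq α] [DecidableEq V]
    (S : Finset α) (supp : α → Finset V) (c : α → V → ℕ) (b : V → ℕ) (hb : ∀ j, 0 < b j)
    (hall : ∀ T ⊆ S, #T ≤ ∑ j ∈ T.biUnion supp, (b j - 1)) :
    ∃ f : V → ℕ, (∀ j, f j < b j) ∧ ∀ i ∈ S, ∃ j ∈ supp i, f j ≠ c i j := by
  obtain ⟨g, hg, hgt⟩ := (all_card_le_biUnion_card_iff_exists_injective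
    (fun i : S => (supp i).sigma fun j => range (b j - 1))).1 (by
      intro T
      have h := hall (T.map (Function.Embedding.subtype _)) (by
        intro x; simp only [mem_map]; rintro ⟨y, -, rfl⟩; exact y.2)
      rw [card_map] at h
      refine h.trans (le_of_eq ?_)
      have : (T.biUnion fun i : S => (supp i).sigma fun j => range (b j - 1)) =
          ((T.map (Function.Embedding.subtype _)).biUnion supp).sigma
            fun j => range (b j - 1) := by
        ext ⟨j, n⟩
        simp only [mem_biUnion, mem_sigma, mem_map, Function.Embedding.subtype_apply]
        constructor
        · rintro ⟨i, hi, hj, hn⟩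
          exact ⟨⟨i, ⟨i, hi, rfl⟩, hj⟩, hn⟩
        · rintro ⟨⟨_, ⟨i, hi, rfl⟩, hj⟩, hn⟩
          exact ⟨i, hi, hj, hn⟩
      rw [this, card_sigma]
      simp)
  -- At most `b j - 1` values are prescribed at `j` by the subboxes matched with it.
  have key : ∀ j, ∃ v < b j, ∀ i : S, (g i).1 = j → v ≠ c i j := by
    intro j
    have hcard : #((univ.filter fun i : S => (g i).1 = j).image fun i : S => c i j) < #(range (b j)) := by
      refine card_image_le.trans_lt ?_
      have : #(univ.filter fun i : S => (g i).1 = j) ≤ #(range (b j - 1)) := by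
        refine card_le_card_of_injOn (fun i => (g i).2) ?_ ?_
        · intro i hi
          have h := hgt i
          simp only [coe_filter, mem_univ, true_and, Set.mem_ofPred_eq] at hi
          rw [mem_sigma, hi] at h
          exact h.2
        · intro i hi i' hi' h
          simp only [coe_filter, mem_univ, true_and, Set.mem_ofPred_eq] at hi hi'
          exact hg (Sigma.ext (hi.trans hi'.symm) (heq_of_eq h))
      rw [card_range] at this ⊢
      have := hb j
      omega
    obtain ⟨v, hv, hv'⟩ := exists_mem_notMem_of_card_lt_card hcard
    refine ⟨v, mem_range.1 hv, fun i hi h => hv' ?_⟩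
    exact mem_image.2 ⟨i, by simpa using hi, h.symm⟩
  choose f hf hf' using key
  refine ⟨f, hf, fun i hi => ⟨(g ⟨i, hi⟩).1, ?_, hf' _ ⟨i, hi⟩ rfl⟩⟩
  exact (mem_sigma.1 (hgt ⟨i, hi⟩)).1

/-- An irredundant cover `F` of the box `∏ j, {0, …, b j - 1}` by subboxes, the subbox `i` being
given by the equations `f j = c i j` for `j ∈ supp i`, has more than `∑ (b j - 1)` members, summed
over the coordinates that occur in it. -/
theorem sum_pred_lt_card_of_irredundant {α V : Type*} [DecidableEq α] [DecidableEq V]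
    (F : Finset α) (supp : α → Finset V) (c : α → V → ℕ) (b : V → ℕ) (hb : ∀ j, 0 < b j)
    (hcov : ∀ f : V → ℕ, (∀ j, f j < b j) → ∃ i ∈ F, ∀ j ∈ supp i, f j = c i j)
    (hirr : ∀ S ⊂ F, ∃ f : V → ℕ, (∀ j, f j < b j) ∧ ∀ i ∈ S, ∃ j ∈ supp i, f j ≠ c i j) :
    ∑ j ∈ F.biUnion supp, (b j - 1) < #F := by
  set w : Finset α → ℕ := fun T => ∑ j ∈ T.biUnion supp, (b j - 1) with hw
  have hne : (F.powerset.filter fun T => w T < #T).Nonempty := by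
    by_contra h
    rw [not_nonempty_iff_eq_empty, filter_eq_empty_iff] at h
    obtain ⟨f, hf, hf'⟩ := exists_forall_ne_of_hall F supp c b hb
      fun T hT => not_lt.1 (h (mem_powerset.2 hT))
    obtain ⟨i, hi, h⟩ := hcov f hf
    obtain ⟨j, hj, hne⟩ := hf' i hi
    exact hne (h j hj)
  -- A largest subfamily `T` that violates Hall's condition. If it is not all of `F`, a point missed
  -- by `T` is corrected, on the coordinates that do not occur in `T`, so that it misses `F \ T` too.
  obtain ⟨T, hT, hmax⟩ := exists_max_image _ card hne
  simp only [mem_filter, mem_powerset] at hT hmax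
  rcases hT.1.eq_or_ssubset with rfl | hlt
  · exact hT.2
  exfalso
  obtain ⟨f₀, hf₀, hf₀'⟩ := hirr T hlt
  obtain ⟨f₁, hf₁, hf₁'⟩ := exists_forall_ne_of_hall (F \ T)
    (fun i => supp i \ T.biUnion supp) c b hb (by
      intro T' hT'
      rcases T'.eq_empty_or_nonempty with rfl | hT'ne
      · simp
      have hdisj : Disjoint T T' :=
        disjoint_of_subset_right hT' disjoint_sdiff
      have hcard := card_union_of_disjoint hdisj
      have h1 : #(T ∪ T') ≤ w (T ∪ T') := by
        by_contra h
        have := hmax (T ∪ T') ⟨union_subset hT.1 (hT'.trans sdiff_subset), not_le.1 h⟩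
        have := hT'ne.card_pos
        omega
      have h2 : w (T ∪ T') = w T +
          ∑ j ∈ T'.biUnion (fun i => supp i \ T.biUnion supp), (b j - 1) := by
        rw [hw, ← sum_union]
        · refine sum_congr (Finset.ext fun j => ?_) fun _ _ => rfl
          simp only [mem_biUnion, mem_union, mem_sdiff]
          grind
        · rw [disjoint_left]
          intro j hj hj'
          obtain ⟨i, -, hi⟩ := mem_biUnion.1 hj'
          exact (mem_sdiff.1 hi).2 hj
      have := hT.2
      omega)
  obtain ⟨i, hi, h⟩ := hcov (fun j => if j ∈ T.biUnion supp then f₀ j else f₁ j)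
    (fun j => by split_ifs <;> simp [hf₀, hf₁])
  by_cases hiT : i ∈ T
  · obtain ⟨j, hj, hne⟩ := hf₀' i hiT
    have := h j hj
    rw [if_pos (mem_biUnion.2 ⟨i, hiT, hj⟩)] at this
    exact hne this
  · obtain ⟨j, hj, hne⟩ := hf₁' i (mem_sdiff.2 ⟨hi, hiT⟩)
    have := h j (mem_sdiff.1 hj).1
    rw [if_neg (mem_sdiff.1 hj).2] at this
    exact hne this

/-! ### The number of members of an irredundant cover by congruence classes -/

theorem modEq_prime_pow_iff_digits (p A x y : ℕ) :
    x ≡ y [MOD p ^ A] ↔ ∀ e < A, x / p ^ e % p = y / p ^ e % p := by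
  induction A with
  | zero => simp [Nat.modEq_one]
  | succ A ih =>
    rw [Nat.forall_lt_succ_right, ← ih]
    constructor
    · intro h
      refine ⟨h.of_dvd (pow_dvd_pow p A.le_succ), ?_⟩
      have h' := congrArg (· / p ^ A) h
      simpa only [pow_succ, Nat.mod_mul_right_div_self] using h'
    · rintro ⟨h1, h2⟩
      rw [Nat.ModEq, Nat.mod_pow_succ, Nat.mod_pow_succ, h1, h2]

theorem exists_digits (p A : ℕ) (f : ℕ → ℕ) (hf : ∀ e, f e < p) :
    ∃ y, ∀ e < A, y / p ^ e % p = f e := by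
  induction A generalizing f with
  | zero => simp
  | succ A ih =>
    obtain ⟨y, hy⟩ := ih (fun e => f (e + 1)) fun e => hf _
    refine ⟨f 0 + p * y, fun e he => ?_⟩
    have hp : 0 < p := (Nat.zero_le _).trans_lt (hf 0)
    cases e with
    | zero => simp [Nat.mod_eq_of_lt (hf 0)]
    | succ e =>
      rw [pow_succ', ← Nat.div_div_eq_div_mul, Nat.add_mul_div_left _ _ hp,
        Nat.div_eq_of_lt (hf 0), zero_add]
      exact hy e (by omega)

/-- The digit positions `⟨p, e⟩` that a congruence modulo `m` prescribes: the lowest `v_p(m)` digits in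
base `p`, for each prime `p`. -/
def digitPositions (m : ℕ) : Finset (Σ _ : ℕ, ℕ) :=
  m.primeFactors.sigma fun p => range (m.factorization p)

/-- The digit of `x` at position `⟨p, e⟩`, that is, the coefficient of `p ^ e` in base `p`. Writing
`p - 1 + 1` for `p` changes nothing for primes, and makes all digit ranges nonempty. -/
def digit (x : ℕ) (j : Σ _ : ℕ, ℕ) : ℕ := x / j.1 ^ j.2 % (j.1 - 1 + 1)

theorem mem_digitPositions {m p e : ℕ} :
    (⟨p, e⟩ : Σ _ : ℕ, ℕ) ∈ digitPositions m ↔ p.Prime ∧ e < m.factorization p := by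
  simp only [digitPositions, mem_sigma, mem_range]
  refine and_congr_left fun h => ?_
  have : p ∈ m.primeFactors := by
    rw [← Nat.support_factorization, Finsupp.mem_support_iff]; omega
  exact ⟨fun h => Nat.prime_of_mem_primeFactors h, fun _ => this⟩

theorem modEq_iff_digit_eq {m : ℕ} (hm : m ≠ 0) (x y : ℕ) :
    x ≡ y [MOD m] ↔ ∀ j ∈ digitPositions m, digit x j = digit y j := by
  have h1 : x ≡ y [MOD m] ↔ ∀ p : ℕ, p.Prime → x ≡ y [MOD p ^ m.factorization p] := by
    constructor
    · exact fun h p _ => h.of_dvd (Nat.ordProj_dvd m p)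
    · intro h
      rw [Nat.modEq_iff_dvd, Int.natCast_dvd]
      rw [Nat.dvd_iff_prime_pow_dvd_dvd]
      intro p k hp hk
      have h2 := (Nat.modEq_iff_dvd.1 (h p hp))
      rw [Int.natCast_dvd] at h2
      exact (pow_dvd_pow p ((hp.pow_dvd_iff_le_factorization hm).1 hk)).trans h2
  rw [h1]
  constructor
  · rintro h ⟨p, e⟩ hj
    obtain ⟨hp, he⟩ := mem_digitPositions.1 hj
    have := (modEq_prime_pow_iff_digits p _ x y).1 (h p hp) e he
    simpa only [digit, Nat.sub_add_cancel hp.one_le] using this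
  · intro h p hp
    refine (modEq_prime_pow_iff_digits p _ x y).2 fun e he => ?_
    have := h ⟨p, e⟩ (mem_digitPositions.2 ⟨hp, he⟩)
    simpa only [digit, Nat.sub_add_cancel hp.one_le] using this

theorem exists_digit_eq (m : ℕ) (f : (Σ _ : ℕ, ℕ) → ℕ)
    (hf : ∀ j, f j < j.1 - 1 + 1) : ∃ x, ∀ j ∈ digitPositions m, digit x j = f j := by
  have hy : ∀ p : ℕ, ∃ y, p.Prime → ∀ e < m.factorization p, y / p ^ e % p = f ⟨p, e⟩ := by
    intro p
    by_cases hp : p.Prime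
    · obtain ⟨y, hy⟩ := exists_digits p (m.factorization p) (fun e => f ⟨p, e⟩) fun e => by
        have := hf ⟨p, e⟩
        rwa [Nat.sub_add_cancel hp.one_le] at this
      exact ⟨y, fun _ => hy⟩
    · exact ⟨0, fun h => absurd h hp⟩
  choose y hy using hy
  obtain ⟨x, hx⟩ := Nat.chineseRemainderOfFinset y (fun p => p ^ m.factorization p)
    m.primeFactors (fun p hp => (pow_pos (Nat.pos_of_mem_primeFactors hp) _).ne')
    (fun p hp q hq hpq => Nat.Coprime.pow _ _ ((Nat.coprime_primes
      (Nat.prime_of_mem_primeFactors hp) (Nat.prime_of_mem_primeFactors hq)).2 hpq))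
  refine ⟨x, ?_⟩
  rintro ⟨p, e⟩ hj
  obtain ⟨hp, he⟩ := mem_digitPositions.1 hj
  have h1 := (modEq_prime_pow_iff_digits p _ _ _).1 (hx p (mem_sigma.1 hj).1) e he
  rw [hy p hp e he] at h1
  simpa only [digit, Nat.sub_add_cancel hp.one_le] using h1

theorem factorization_lcm_lt {ι : Type*} {F : Finset ι} {m : ι → ℕ}
    (hm : ∀ i ∈ F, m i ≠ 0) {p e : ℕ} (h : e < (F.lcm m).factorization p) :
    ∃ i ∈ F, e < (m i).factorization p := by
  rw [Finset.factorization_lcm hm] at h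
  simpa using h

/-- Simpson's bound: if the least common multiple of the moduli of an irredundant cover is
`∏ p ^ a_p`, then the cover has more than `∑ a_p (p - 1)` members. -/
theorem sum_factorization_mul_lt_card {ι : Type*} [DecidableEq ι] (F : Finset ι) (r : ι → ℤ)
    (m : ι → ℕ) (hm : ∀ i ∈ F, m i ≠ 0)
    (hcov : ∀ x : ℤ, ∃ i ∈ F, x ≡ r i [ZMOD m i])
    (hirr : ∀ S ⊂ F, ∃ x : ℤ, ∀ i ∈ S, ¬ x ≡ r i [ZMOD m i]) :
    ∑ p ∈ (F.lcm m).primeFactors, (F.lcm m).factorization p * (p - 1) < #F := by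
  have hL : F.lcm m ≠ 0 := by
    rw [Ne, Finset.lcm_eq_zero_iff]; simpa using hm
  set L := F.lcm m with hLdef
  have hmod : ∀ i ∈ F, ∀ x : ℕ, (x : ℤ) ≡ r i [ZMOD m i] ↔
      ∀ j ∈ digitPositions (m i), digit x j = digit (r i % m i).toNat j := by
    intro i hi x
    have hm0 : (m i : ℤ) ≠ 0 := by exact_mod_cast hm i hi
    rw [← modEq_iff_digit_eq (hm i hi), ← Int.natCast_modEq_iff,
      Int.toNat_of_nonneg (Int.emod_nonneg _ hm0)]
    have := Int.mod_modEq (r i) (m i)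
    exact ⟨fun h => h.trans this.symm, fun h => h.trans this⟩
  have key := sum_pred_lt_card_of_irredundant F (fun i => digitPositions (m i))
    (fun i => digit (r i % m i).toNat) (fun j => j.1 - 1 + 1) (fun j => Nat.succ_pos _)
    (by
      intro f hf
      obtain ⟨x, hx⟩ := exists_digit_eq L f hf
      obtain ⟨i, hi, h⟩ := hcov x
      refine ⟨i, hi, ?_⟩
      rintro ⟨p, e⟩ hj
      rw [← (hmod i hi x).1 h _ hj]
      obtain ⟨hp, he⟩ := mem_digitPositions.1 hj
      refine (hx _ (mem_digitPositions.2 ⟨hp, he.trans_le ?_⟩)).symm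
      exact (Nat.factorization_le_iff_dvd (hm i hi) hL).2 (dvd_lcm hi) p)
    (by
      intro S hS
      obtain ⟨x, hx⟩ := hirr S hS
      have hL0 : (L : ℤ) ≠ 0 := by exact_mod_cast hL
      refine ⟨digit (x % L).toNat, fun j => Nat.mod_lt _ (Nat.succ_pos _), fun i hi => ?_⟩
      have hiF := hS.1 hi
      by_contra! h
      refine hx i hi (Int.ModEq.trans ?_ ((hmod i hiF _).2 h))
      rw [Int.toNat_of_nonneg (Int.emod_nonneg _ hL0)]
      exact (Int.mod_modEq x L).symm.of_dvd (by exact_mod_cast dvd_lcm hiF))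
  refine lt_of_le_of_lt ?_ key
  have : ∑ p ∈ L.primeFactors, L.factorization p * (p - 1) =
      ∑ j ∈ digitPositions L, (j.1 - 1) := by
    rw [digitPositions, sum_sigma]
    simp
  rw [this]
  refine sum_le_sum_of_subset ?_
  rintro ⟨p, e⟩ hj
  obtain ⟨hp, he⟩ := mem_digitPositions.1 hj
  obtain ⟨i, hi, h⟩ := factorization_lcm_lt hm he
  exact mem_biUnion.2 ⟨i, hi, mem_digitPositions.2 ⟨hp, h⟩⟩

/-! ### Sets of residues as numbers -/

namespace CoverSearch

/-- A finite set `U` of natural numbers written in base `1024`, with digits `0` and `1`. Intersections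
become bitwise conjunctions, and the cardinality is the remainder modulo `1023`. -/
def encode (U : Finset ℕ) : ℕ := ∑ x ∈ U, 1024 ^ x

theorem encode_mod (U : Finset ℕ) (h : #U < 1023) : encode U % 1023 = #U := by
  have : encode U ≡ #U [MOD 1023] := by
    have : (∑ x ∈ U, 1024 ^ x) ≡ ∑ x ∈ U, 1 [MOD 1023] := by
      rw [← ZMod.natCast_eq_natCast_iff]
      push_cast
      refine sum_congr rfl fun x _ => ?_
      rw [show (1024 : ZMod 1023) = 1 from by decide, one_pow]
    simpa [encode] using this
  rw [this, Nat.mod_eq_of_lt h]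

theorem encode_pos {U : Finset ℕ} (h : encode U ≠ 0) : U.Nonempty := by
  rw [nonempty_iff_ne_empty]; rintro rfl; simp [encode] at h

theorem testBit_encode (U : Finset ℕ) (k : ℕ) :
    (encode U).testBit k = true ↔ ∃ x ∈ U, k = 10 * x := by
  have h : ∑ i ∈ U.image (fun x => 10 * x), 2 ^ i = encode U := by
    rw [sum_image (by intro a _ b _ h; dsimp only at h; omega)]
    refine sum_congr rfl fun x _ => ?_
    rw [pow_mul]; norm_num
  rw [← h, ← Nat.mem_bitIndices, ← List.mem_toFinset, toFinset_bitIndices_sum_two_pow]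
  simp [eq_comm]

theorem encode_land (U C : Finset ℕ) : encode U &&& encode C = encode (U ∩ C) := by
  refine Nat.eq_of_testBit_eq fun k => ?_
  rw [Bool.eq_iff_iff, Nat.testBit_land, Bool.and_eq_true]
  simp only [testBit_encode, mem_inter]
  grind

theorem encode_sub_land (U C : Finset ℕ) :
    encode U - (encode U &&& encode C) = encode (U \ C) := by
  rw [encode_land, encode, encode, encode, ← sum_inter_add_sum_sdiff U C, Nat.add_sub_cancel_left]

/-- The code of the multiples of `m` in `{0, …, N - 1}`, for a positive divisor `m` of `N`: a geometric
sum in closed form. -/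
def mask (N m : ℕ) : ℕ := (1024 ^ N - 1) / (1024 ^ m - 1)

theorem filter_mod_eq_image {N m r : ℕ} (hN : m ∣ N) (hr : r < m) :
    (range N).filter (fun x => x % m = r) = (range (N / m)).image fun q => m * q + r := by
  obtain ⟨k, rfl⟩ := hN
  rw [Nat.mul_div_cancel_left k ((Nat.zero_le r).trans_lt hr)]
  ext x
  simp only [mem_filter, mem_range, mem_image]
  constructor
  · rintro ⟨hx, rfl⟩
    exact ⟨x / m, Nat.div_lt_of_lt_mul hx, Nat.div_add_mod x m⟩
  · rintro ⟨q, hq, rfl⟩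
    refine ⟨?_, by rw [Nat.mul_add_mod, Nat.mod_eq_of_lt hr]⟩
    nlinarith

theorem card_filter_mod_eq_le {N m r : ℕ} (hN : m ∣ N) (hr : r < m) :
    #((range N).filter fun x => x % m = r) ≤ N / m := by
  rw [filter_mod_eq_image hN hr]
  exact card_image_le.trans_eq (card_range _)

theorem mask_mul {N m r : ℕ} (hN : m ∣ N) (hr : r < m) :
    mask N m * 1024 ^ r = encode ((range N).filter fun x => x % m = r) := by
  have hm : 0 < m := (Nat.zero_le r).trans_lt hr
  rw [encode, filter_mod_eq_image hN hr, sum_image]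
  · obtain ⟨k, rfl⟩ := hN
    have h1 : 2 ≤ 1024 ^ m :=
      (by norm_num : 2 ≤ 1024 ^ 1).trans (Nat.pow_le_pow_right (by norm_num) hm)
    rw [mask, pow_mul, ← Nat.geomSum_eq h1, sum_mul, Nat.mul_div_cancel_left k hm]
    exact sum_congr rfl fun q _ => by rw [pow_add, pow_mul]
  · intro a _ b _ h
    exact Nat.eq_of_mul_eq_mul_left hm (by simpa using h)

/-! ### The search -/

/-- The largest number of elements that one of the classes `0, …, n - 1` has in common with the set
coded by `u`, where `M` is the code of the class of `0`. -/
def maxHit (u M : ℕ) : ℕ → ℕ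
  | 0 => 0
  | r + 1 => max (maxHit u M r) ((u &&& (M * 1024 ^ r)) % 1023)

theorem le_maxHit (u M : ℕ) {r n : ℕ} (h : r < n) :
    (u &&& (M * 1024 ^ r)) % 1023 ≤ maxHit u M n := by
  induction n with
  | zero => omega
  | succ n ih =>
    rw [maxHit]
    rcases Nat.lt_succ_iff_lt_or_eq.1 h with h | rfl
    · exact (ih h).trans (le_max_left _ _)
    · exact le_max_right _ _

/-- An upper bound for the number of elements that a class modulo `m` has in common with the set
coded by `u`. It is exact for `m ≤ 36`; for larger `m` the size of the whole class is good enough,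
and quicker to find. -/
def hit (N u m : ℕ) : ℕ := if m ≤ 36 then maxHit u (mask N m) m else N / m

/-- The value `f n`, by a case distinction on `n`. In the kernel the case distinction
evaluates `n` before it enters `f`, so that the work is not repeated at each use of the argument. -/
def force (n : ℕ) (f : ℕ → Bool) : Bool := match n with
  | 0 => f 0
  | k + 1 => f (k + 1)

theorem force_eq (n : ℕ) (f : ℕ → Bool) : force n f = f n := by
  cases n <;> rfl

/-- Passes the evaluated list of the numbers `hit N u m`, for `m` in a list, to `k`. -/
def withHits (N u : ℕ) : List ℕ → (List ℕ → Bool) → Bool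
  | [], k => k []
  | m :: R, k => force (hit N u m) fun c => withHits N u R fun cs => k (c :: cs)

theorem withHits_eq (N u : ℕ) (R : List ℕ) (k : List ℕ → Bool) :
    withHits N u R k = k (R.map (hit N u)) := by
  induction R generalizing k with
  | nil => rfl
  | cons m R ih => rw [withHits, force_eq, ih, List.map_cons]

/-- Whether the set coded by `u` is too large to be covered by `t` classes with distinct moduli in
`R`. For every `b`, the sum of the `t` largest hits `c` is at most `t * b + ∑ (c - b)⁺`, with
equality when `b` is the `t`-th largest of them, so it suffices to try the hits themselves for `b`. -/
def prune (N u t : ℕ) (R : List ℕ) : Bool :=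
  withHits N u R fun cs =>
    cs.any fun b => decide (t * b + (cs.map fun c => c - b).sum < u % 1023)

/-- A search certifying that the set coded by `u`, which is invariant under translation by `l`, is
not covered by `t` classes with distinct moduli in the list: either it is too large, or the first
modulus `m` can neither be used, with a residue less than `gcd l m`, nor be left out. -/
def refute (N : ℕ) : List ℕ → ℕ → ℕ → ℕ → Bool
  | [], u, _, _ => decide (u ≠ 0)
  | m :: R, u, t, l =>
    prune N u t (m :: R) ||
      (decide (t ≠ 0) && ((List.range (Nat.gcd l m)).all fun r =>
        refute N R (u - (u &&& (mask N m * 1024 ^ r))) (t - 1) (Nat.lcm l m)) &&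
      refute N R u t l)

/-- The divisors of `N` that exceed `2`, in increasing order. -/
def moduli (N : ℕ) : List ℕ := (List.range (N + 1)).filter fun d => decide (2 < d) && N % d == 0

/-! ### Soundness of the search -/

theorem sum_le_list_sum (g : ℕ → ℕ) (R : List ℕ) (S : Finset ℕ) (h : ∀ m ∈ S, m ∈ R) :
    ∑ m ∈ S, g m ≤ (R.map g).sum := by
  induction R generalizing S with
  | nil =>
    rw [eq_empty_of_forall_notMem (s := S) fun x hx => by simpa using h x hx]; simp
  | cons m R ih =>
    have h1 := ih (S.erase m) fun x hx => by
      have := h x (mem_of_mem_erase hx)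
      rcases List.mem_cons.1 this with rfl | h
      · simp at hx
      · exact h
    rw [List.map_cons, List.sum_cons]
    by_cases hm : m ∈ S
    · rw [← add_sum_erase S g hm]; omega
    · rw [erase_eq_of_notMem hm] at h1; omega

/-- The elements of `U` in `{0, …, N - 1}`. -/
noncomputable def reps (N : ℕ) (U : Set ℤ) : Finset ℕ :=
  open Classical in (range N).filter fun x => (x : ℤ) ∈ U

theorem mem_reps {N : ℕ} {U : Set ℤ} {x : ℕ} : x ∈ reps N U ↔ x < N ∧ (x : ℤ) ∈ U := by
  simp [reps]

theorem card_reps_le (N : ℕ) (U : Set ℤ) : #(reps N U) ≤ N := by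
  classical
  exact (card_filter_le _ _).trans_eq (card_range N)

theorem card_reps_inter_le_hit {N m r : ℕ} (hN : N < 1023) (U : Set ℤ) (hmN : m ∣ N)
    (hr : r < m) :
    #(reps N U ∩ (range N).filter fun x => x % m = r) ≤ hit N (encode (reps N U)) m := by
  rw [hit]
  split_ifs
  · have := le_maxHit (encode (reps N U)) (mask N m) hr
    rwa [mask_mul hmN hr, encode_land, encode_mod] at this
    exact ((card_le_card inter_subset_left).trans (card_reps_le N U)).trans_lt hN
  · exact (card_le_card inter_subset_right).trans (card_filter_mod_eq_le hmN hr)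

theorem prune_sound {N t : ℕ} (hN : N < 1023) {R : List ℕ} {U : Set ℤ}
    (hR : ∀ m ∈ R, 0 < m ∧ m ∣ N) (h : prune N (encode (reps N U)) t R = true)
    {S : Finset ℕ} (hS : ∀ m ∈ S, m ∈ R) (hSt : #S ≤ t) (a : ℕ → ℤ) :
    ∃ x ∈ U, ∀ m ∈ S, ¬ x ≡ a m [ZMOD m] := by
  by_contra! hcov
  simp only [prune, withHits_eq, List.any_eq_true, decide_eq_true_eq] at h
  obtain ⟨b, -, hb⟩ := h
  rw [encode_mod _ ((card_reps_le N U).trans_lt hN)] at hb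
  set g : ℕ → ℕ := hit N (encode (reps N U)) with hg
  have h1 : #(reps N U) ≤ ∑ m ∈ S, g m := by
    have hsub : reps N U ⊆
        S.biUnion fun m => reps N U ∩ (range N).filter fun x => x % m = (a m % m).toNat := by
      intro x hx
      obtain ⟨m, hm, hxm⟩ := hcov x (mem_reps.1 hx).2
      refine mem_biUnion.2 ⟨m, hm, mem_inter.2 ⟨hx, mem_filter.2
        ⟨mem_range.2 (mem_reps.1 hx).1, ?_⟩⟩⟩
      rw [← hxm]
      omega
    refine (card_le_card hsub).trans (card_biUnion_le.trans (sum_le_sum fun m hm => ?_))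
    obtain ⟨hm0, hmN⟩ := hR m (hS m hm)
    have hr : (a m % m).toNat < m := by
      have := Int.emod_lt_of_pos (a m) (by exact_mod_cast hm0 : (0 : ℤ) < m)
      omega
    exact card_reps_inter_le_hit hN U hmN hr
  have h2 : ∑ m ∈ S, g m ≤ #S * b + ∑ m ∈ S, (g m - b) := by
    rw [← smul_eq_mul, ← sum_const, ← sum_add_distrib]
    exact sum_le_sum fun m _ => by omega
  have h3 := sum_le_list_sum (fun m => g m - b) R S hS
  have h4 : #S * b ≤ t * b := Nat.mul_le_mul_right b hSt
  rw [List.map_map] at hb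
  have h5 : (R.map ((fun x => x - b) ∘ g)).sum = (R.map fun m => g m - b).sum := rfl
  omega

/-- Translating by a multiple of `l` brings a residue modulo `m` below `gcd l m`. -/
theorem exists_shift (a : ℤ) (l : ℕ) {m : ℕ} (hm : 0 < m) :
    ∃ v : ℤ, ∃ r < Nat.gcd l m, a + v * l ≡ r [ZMOD m] := by
  have hg : (0 : ℤ) < Nat.gcd l m := by exact_mod_cast Nat.gcd_pos_of_pos_right l hm
  refine ⟨-(a / (Nat.gcd l m)) * Nat.gcdA l m, (a % (Nat.gcd l m)).toNat, ?_, ?_⟩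
  · have := Int.emod_lt_of_pos a hg
    omega
  · rw [Int.toNat_of_nonneg (Int.emod_nonneg _ hg.ne')]
    have h1 := Nat.gcd_eq_gcd_ab l m
    have h2 := Int.emod_add_mul_ediv a (Nat.gcd l m)
    rw [Int.modEq_iff_dvd]
    refine ⟨-(a / (Nat.gcd l m)) * Nat.gcdB l m, ?_⟩
    set q := a / (Nat.gcd l m)
    linear_combination h2 - q * h1

/-- If the search succeeds, then a set `U` of integers invariant under translation by `l` is not
covered by `t` classes with distinct moduli in `R`. -/
theorem refute_sound {N : ℕ} (hN : N < 1023) (R : List ℕ) (hR : ∀ m ∈ R, 0 < m ∧ m ∣ N)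
    (U : Set ℤ) (t l : ℕ) (hU : ∀ v : ℤ, ∀ x, x ∈ U ↔ x + v * l ∈ U)
    (h : refute N R (encode (reps N U)) t l = true)
    (S : Finset ℕ) (hS : ∀ m ∈ S, m ∈ R) (hSt : #S ≤ t) (a : ℕ → ℤ) :
    ∃ x ∈ U, ∀ m ∈ S, ¬ x ≡ a m [ZMOD m] := by
  induction R generalizing U t l S a with
  | nil =>
    simp only [refute, decide_eq_true_eq] at h
    obtain ⟨x, hx⟩ := encode_pos h
    exact ⟨x, (mem_reps.1 hx).2, fun m hm => by simpa using hS m hm⟩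
  | cons m R ih =>
    have hRt : ∀ m ∈ R, 0 < m ∧ m ∣ N := fun x hx => hR x (List.mem_cons_of_mem _ hx)
    rw [refute, Bool.or_eq_true, Bool.and_eq_true, Bool.and_eq_true, decide_eq_true_eq,
      List.all_eq_true] at h
    rcases h with h | ⟨⟨ht, h⟩, h'⟩
    · exact prune_sound hN hR h hS hSt a
    by_cases hm : m ∈ S
    swap
    · refine ih hRt U t l hU h' S (fun x hx => ?_) hSt a
      rcases List.mem_cons.1 (hS x hx) with rfl | h
      · exact absurd hx hm
      · exact h
    obtain ⟨hm0, hmN⟩ := hR m (by simp)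
    -- After a translation by `v * l` the class of `m` has residue `r`, and `U` is unchanged.
    obtain ⟨v, r, hr, hvr⟩ := exists_shift (a m) l hm0
    have hrm : r < m := hr.trans_le (Nat.gcd_le_right _ hm0)
    have h := h r (List.mem_range.2 hr)
    rw [mask_mul hmN hrm, encode_sub_land] at h
    have hset : reps N U \ (range N).filter (fun x => x % m = r) =
        reps N {x ∈ U | ¬ x ≡ r [ZMOD m]} := by
      ext x
      have : (x : ℤ) ≡ r [ZMOD m] ↔ x % m = r := by
        rw [Int.natCast_modEq_iff, Nat.ModEq, Nat.mod_eq_of_lt hrm]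
      simp only [mem_sdiff, mem_filter, mem_range, mem_reps, Set.mem_ofPred_eq, this]
      tauto
    rw [hset] at h
    obtain ⟨x, ⟨hxU, hxr⟩, hx⟩ := ih hRt _ (t - 1) (Nat.lcm l m) (by
      intro w x
      have hl : ∃ k : ℤ, ((Nat.lcm l m : ℕ) : ℤ) = k * l := by
        obtain ⟨k, hk⟩ := Nat.dvd_lcm_left l m
        exact ⟨k, by rw [hk]; push_cast; ring⟩
      obtain ⟨k, hk⟩ := hl
      have h1 : x ∈ U ↔ x + w * (Nat.lcm l m : ℕ) ∈ U := by
        rw [hk, ← mul_assoc]; exact hU _ _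
      have h2 : x + w * (Nat.lcm l m : ℕ) ≡ x [ZMOD m] := by
        rw [Int.modEq_iff_dvd]
        have : (m : ℤ) ∣ (Nat.lcm l m : ℕ) := by exact_mod_cast Nat.dvd_lcm_right l m
        simpa using this.mul_left w
      simp only [Set.mem_ofPred_eq, ← h1]
      exact and_congr_right fun _ => not_congr ⟨h2.trans, h2.symm.trans⟩)
      h (S.erase m) (fun y hy => by
        rcases List.mem_cons.1 (hS y (mem_of_mem_erase hy)) with rfl | h
        · simp at hy
        · exact h) (by rw [card_erase_of_mem hm]; omega) (fun m => a m + v * l)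
    refine ⟨x - v * l, ?_, fun y hy hxy => ?_⟩
    · rw [hU v, sub_add_cancel]; exact hxU
    · have h3 : x ≡ a y + v * l [ZMOD y] := by
        have := hxy.add_right (v * l)
        rwa [sub_add_cancel] at this
      rcases eq_or_ne y m with rfl | hne
      · exact hxr (h3.trans hvr)
      · exact hx y (mem_erase.2 ⟨hne, hy⟩) h3

theorem exists_not_covered_of_refute {N : ℕ} (hN0 : 0 < N) (hN : N < 1023)
    (h : refute N (moduli N) (mask N 1) 10 1 = true)
    (S : Finset ℕ) (hS : ∀ m ∈ S, 2 < m ∧ m ∣ N) (hSt : #S ≤ 10) (a : ℕ → ℤ) :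
    ∃ x : ℤ, ∀ m ∈ S, ¬ x ≡ a m [ZMOD m] := by
  have hu : mask N 1 = encode (reps N Set.univ) := by
    have := mask_mul (N := N) (m := 1) (r := 0) (one_dvd _) one_pos
    rw [pow_zero, mul_one] at this
    rw [this]
    congr 1
    ext x
    simp [mem_reps, Nat.mod_one]
  rw [hu] at h
  obtain ⟨x, -, hx⟩ := refute_sound hN (moduli N) (by
    intro m hm
    simp only [moduli, List.mem_filter, Bool.and_eq_true, decide_eq_true_eq, beq_iff_eq] at hm
    exact ⟨by omega, Nat.dvd_of_mod_eq_zero hm.2.2⟩) Set.univ 10 1 (by simp) h S (by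
    intro m hm
    obtain ⟨h1, h2⟩ := hS m hm
    simp only [moduli, List.mem_filter, Bool.and_eq_true, decide_eq_true_eq, beq_iff_eq,
      List.mem_range]
    exact ⟨Nat.lt_succ_of_le (Nat.le_of_dvd hN0 h2), h1, Nat.mod_eq_zero_of_dvd h2⟩) hSt a
  exact ⟨x, hx⟩

/-- The numbers in this list are the maximal ones, for divisibility, among the `N` with
`∑ v_p(N) (p - 1) ≤ 9`. -/
theorem refute_all : ∀ N ∈ [512, 384, 288, 216, 162, 160, 120, 90, 56, 50, 42],
    refute N (moduli N) (mask N 1) 10 1 = true := by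
  decide +kernel

end CoverSearch

/-! ### Ten congruences -/

theorem dvd_of_sum_factorization_le {L : ℕ} (hL : L ≠ 0)
    (h : ∑ p ∈ L.primeFactors, L.factorization p * (p - 1) ≤ 9) :
    ∃ N ∈ [512, 384, 288, 216, 162, 160, 120, 90, 56, 50, 42], L ∣ N := by
  have hP : L.primeFactors ⊆ {2, 3, 5, 7} := by
    intro p hp
    have h1 := single_le_sum (f := fun p => L.factorization p * (p - 1))
      (fun _ _ => Nat.zero_le _) hp
    have hpp := Nat.prime_of_mem_primeFactors hp
    have h2 : 0 < L.factorization p :=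
      hpp.factorization_pos_of_dvd hL (Nat.dvd_of_mem_primeFactors hp)
    have h3 : p - 1 ≤ L.factorization p * (p - 1) := Nat.le_mul_of_pos_left _ h2
    have h4 : p ≤ 10 := by
      have := h1.trans h
      omega
    interval_cases p <;> first | decide | (exact absurd hpp (by norm_num))
  have h0 : ∀ p ∈ ({2, 3, 5, 7} : Finset ℕ), p ∉ L.primeFactors → L.factorization p = 0 := by
    intro p _ hp
    rwa [← Nat.support_factorization, Finsupp.notMem_support_iff] at hp
  have hsum := sum_subset hP (f := fun p => L.factorization p * (p - 1))
    fun p hp hp' => by simp [h0 p hp hp']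
  have hprod : L = ∏ p ∈ ({2, 3, 5, 7} : Finset ℕ), p ^ L.factorization p := by
    conv_lhs => rw [← Nat.prod_factorization_pow_eq_self hL]
    exact prod_subset hP fun p hp hp' => by simp [h0 p hp hp']
  rw [hsum] at h
  rw [sum_insert (by decide), sum_insert (by decide), sum_insert (by decide), sum_singleton] at h
  rw [prod_insert (by decide), prod_insert (by decide), prod_insert (by decide),
    prod_singleton] at hprod
  generalize L.factorization 2 = a at *
  generalize L.factorization 3 = b at *
  generalize L.factorization 5 = c at *
  generalize L.factorization 7 = d at *
  have main : ∀ A B C D N : ℕ, a ≤ A → b ≤ B → c ≤ C → d ≤ D →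
      2 ^ A * (3 ^ B * (5 ^ C * 7 ^ D)) = N → L ∣ N := by
    rintro A B C D N hA hB hC hD rfl
    rw [hprod]
    gcongr
  have : (a ≤ 9 ∧ b ≤ 0 ∧ c ≤ 0 ∧ d ≤ 0) ∨
      (a ≤ 7 ∧ b ≤ 1 ∧ c ≤ 0 ∧ d ≤ 0) ∨
      (a ≤ 5 ∧ b ≤ 2 ∧ c ≤ 0 ∧ d ≤ 0) ∨
      (a ≤ 3 ∧ b ≤ 3 ∧ c ≤ 0 ∧ d ≤ 0) ∨
      (a ≤ 1 ∧ b ≤ 4 ∧ c ≤ 0 ∧ d ≤ 0) ∨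
      (a ≤ 5 ∧ b ≤ 0 ∧ c ≤ 1 ∧ d ≤ 0) ∨
      (a ≤ 3 ∧ b ≤ 1 ∧ c ≤ 1 ∧ d ≤ 0) ∨
      (a ≤ 1 ∧ b ≤ 2 ∧ c ≤ 1 ∧ d ≤ 0) ∨
      (a ≤ 3 ∧ b ≤ 0 ∧ c ≤ 0 ∧ d ≤ 1) ∨
      (a ≤ 1 ∧ b ≤ 0 ∧ c ≤ 2 ∧ d ≤ 0) ∨
      (a ≤ 1 ∧ b ≤ 1 ∧ c ≤ 0 ∧ d ≤ 1) := by omega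
  rcases this with ⟨hA, hB, hC, hD⟩ | ⟨hA, hB, hC, hD⟩ | ⟨hA, hB, hC, hD⟩ | ⟨hA, hB, hC, hD⟩ |
    ⟨hA, hB, hC, hD⟩ | ⟨hA, hB, hC, hD⟩ | ⟨hA, hB, hC, hD⟩ | ⟨hA, hB, hC, hD⟩ |
    ⟨hA, hB, hC, hD⟩ | ⟨hA, hB, hC, hD⟩ | ⟨hA, hB, hC, hD⟩
  · exact ⟨512, by simp, main _ _ _ _ _ hA hB hC hD rfl⟩
  · exact ⟨384, by simp, main _ _ _ _ _ hA hB hC hD rfl⟩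
  · exact ⟨288, by simp, main _ _ _ _ _ hA hB hC hD rfl⟩
  · exact ⟨216, by simp, main _ _ _ _ _ hA hB hC hD rfl⟩
  · exact ⟨162, by simp, main _ _ _ _ _ hA hB hC hD rfl⟩
  · exact ⟨160, by simp, main _ _ _ _ _ hA hB hC hD rfl⟩
  · exact ⟨120, by simp, main _ _ _ _ _ hA hB hC hD rfl⟩
  · exact ⟨90, by simp, main _ _ _ _ _ hA hB hC hD rfl⟩
  · exact ⟨56, by simp, main _ _ _ _ _ hA hB hC hD rfl⟩
  · exact ⟨50, by simp, main _ _ _ _ _ hA hB hC hD rfl⟩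
  · exact ⟨42, by simp, main _ _ _ _ _ hA hB hC hD rfl⟩

theorem eleven_le_of_isCovering {k : ℕ} {S : CongruenceSystem k} (hc : S.IsCovering)
    (hd : S.IsDistinct) (h2 : ∀ i, 2 < S.modulus i) : 11 ≤ k := by
  by_contra hk
  set cov : Finset (Fin k) → Prop := fun F => ∀ x : ℤ, ∃ i ∈ F, x ≡ S.residue i [ZMOD S.modulus i]
  -- An irredundant subcover; the lower bound on the number of congruences only holds for these.
  obtain ⟨F, hF, hmin⟩ : ∃ F, cov F ∧ ∀ G ⊂ F, ¬ cov G := by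
    obtain ⟨F, hF⟩ := (Set.toFinite {F | cov F}).exists_minimal
      ⟨univ, fun x => (hc x).imp fun i hi => ⟨mem_univ i, hi⟩⟩
    exact ⟨F, hF.prop, fun G hG hG' => hF.not_lt hG' hG⟩
  have hm : ∀ i ∈ F, S.modulus i ≠ 0 := fun i _ => by have := h2 i; omega
  have hcard : #F ≤ k := (card_le_univ F).trans_eq (Fintype.card_fin k)
  have hsum := sum_factorization_mul_lt_card F S.residue S.modulus hm hF fun G hG => by
    have := hmin G hG
    simpa only [cov, not_forall, not_exists, not_and] using this
  have hL : F.lcm S.modulus ≠ 0 := by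
    rw [Ne, Finset.lcm_eq_zero_iff]; simpa using hm
  obtain ⟨N, hN, hLN⟩ := dvd_of_sum_factorization_le hL (by omega)
  have hN0 : 0 < N ∧ N < 1023 := by
    have : ∀ N ∈ [512, 384, 288, 216, 162, 160, 120, 90, 56, 50, 42], 0 < N ∧ N < 1023 := by
      decide
    exact this N hN
  obtain ⟨x, hx⟩ := CoverSearch.exists_not_covered_of_refute hN0.1 hN0.2
    (CoverSearch.refute_all N hN) (F.image S.modulus) (by
      intro m hm
      obtain ⟨i, hi, rfl⟩ := mem_image.1 hm
      exact ⟨h2 i, (dvd_lcm hi).trans hLN⟩)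
    (card_image_le.trans (by omega)) (Function.extend S.modulus S.residue 0)
  obtain ⟨i, hi, h⟩ := hF x
  refine hx _ (mem_image_of_mem _ hi) ?_
  rwa [Function.Injective.extend_apply hd]

/-! ### Krukenberg's system -/

theorem CongruenceSystem.krukenberg_isCovering : CongruenceSystem.krukenberg.IsCovering := by
  intro n
  have h : ∀ x : Fin 144, ∃ i, (x : ℤ) ≡ krukenberg.residue i [ZMOD krukenberg.modulus i] := by
    decide +kernel
  have hdvd : ∀ i, krukenberg.modulus i ∣ 144 := by decide
  obtain ⟨i, hi⟩ := h ⟨(n % 144).toNat, by omega⟩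
  refine ⟨i, Int.ModEq.trans ?_ hi⟩
  rw [Int.toNat_of_nonneg (by omega)]
  exact (Int.mod_modEq n 144).symm.of_dvd (by exact_mod_cast hdvd i)

end

theorem mainTheorem1 :
    IsLeast {k : ℕ | ∃ S : CongruenceSystem k,
      S.IsCovering ∧ S.IsDistinct ∧ ∀ i, 2 < S.modulus i} 11 ∧
    CongruenceSystem.krukenberg.IsCovering ∧
    CongruenceSystem.krukenberg.IsDistinct ∧
    ∀ i, 2 < CongruenceSystem.krukenberg.modulus i := by
  have hd : CongruenceSystem.krukenberg.IsDistinct := by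
    unfold CongruenceSystem.IsDistinct
    decide
  have h2 : ∀ i, 2 < CongruenceSystem.krukenberg.modulus i := by decide
  have hc := CongruenceSystem.krukenberg_isCovering
  exact ⟨⟨⟨_, hc, hd, h2⟩, fun _ ⟨_, hc, hd, h2⟩ => eleven_le_of_isCovering hc hd h2⟩, hc, hd, h2⟩
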